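/- For an integrable function $f:\mathbb{R}\to\mathbb{R}$ let $\widehat f(y)=\int_{\mathbb{R}} f(x)e^{-2\pi i xy}\,dx$; if $f$ is even, then $\widehat f$ is real-valued and even. For $g:\mathbb{R}\to\mathbb{R}$ put $$A(g):=\inf\{r>0:\ g(x)\ge 0 \text{ whenever } |x|>r\}\in[0,\infty],\qquad \inf\emptyset=\infty .$$ Let $\mathcal{A}$ be the set of all nonzero, even, continuous, integrable functions $f:\mathbb{R}\to\mathbb{R}$ with integrable Fourier transform such that $f(0)\le 0$ and $\widehat f(0)\le 0$. (An integrable function with integrable Fourier transform agrees almost everywhere with a unique continuous function, and $f$ denotes this continuous representative.) **Theorem.** For every $f\in\mathcal{A}$, $$A(f)\,A(\widehat f)\ \ge\ 0.2025,$$ and the constant $0.2025$ cannot be replaced by $0.353$; that is, it is not true that $A(f)A(\widehat f)\ge 0.353$ for all $f\in\mathcal{A}$. -/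

import Mathlib

open MeasureTheory Set
open scoped ENNReal FourierTransform

noncomputable section

/-- The Fourier transform `y ↦ ∫ f(x) exp(-2πixy) dx` of a real-valued function on the line. -/
def cfourier (f : ℝ → ℝ) : ℝ → ℂ :=
  𝓕 (fun x : ℝ => (f x : ℂ))

/-- The Fourier transform of a real-valued function `f`, as a real-valued function. When `f` is
even the Fourier transform is real-valued, so that nothing is lost by taking the real part: see
`coe_rfourier`. -/
def rfourier (f : ℝ → ℝ) : ℝ → ℝ :=
  fun y => (cfourier f y).re

theorem cfourier_eq_integral (f : ℝ → ℝ) (y : ℝ) :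
    cfourier f y = ∫ x : ℝ, Complex.exp (-2 * Real.pi * Complex.I * x * y) * (f x : ℂ) := by
  unfold cfourier
  rw [Real.fourier_real_eq_integral_exp_smul]
  congr 1
  ext x
  rw [smul_eq_mul]
  congr 2
  push_cast
  ring

theorem coe_rfourier {f : ℝ → ℝ} (hf : Function.Even f) (y : ℝ) :
    (rfourier f y : ℂ) = cfourier f y := by
  unfold rfourier
  rw [← Complex.conj_eq_iff_re, cfourier_eq_integral, ← integral_conj,
    ← integral_neg_eq_self]
  congr 1
  ext x
  rw [map_mul, ← Complex.exp_conj, Complex.conj_ofReal, hf x]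
  simp [map_ofNat]

/-- `A(f) = inf {r > 0 : f(x) ≥ 0 whenever |x| > r}`, which is `∞` when there is no such `r`. -/
def lastSign (f : ℝ → ℝ) : ℝ≥0∞ :=
  sInf {a : ℝ≥0∞ | ∃ r : ℝ, 0 < r ∧ (∀ x : ℝ, r < |x| → 0 ≤ f x) ∧ a = ENNReal.ofReal r}

/-- The nonzero, even, integrable functions `f : ℝ → ℝ` with integrable Fourier transform such that
`f(0) ≤ 0` and `f̂(0) ≤ 0`. An integrable function with integrable Fourier transform agrees almost
everywhere with exactly one continuous function; `f` is that representative, which is what gives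
the value `f(0)` (and the condition that `f` is nonzero) a meaning. -/
structure IsAdmissible (f : ℝ → ℝ) : Prop where
  continuous : Continuous f
  ne_zero : f ≠ 0
  even : Function.Even f
  integrable : Integrable f
  integrable_fourier : Integrable (cfourier f)
  apply_zero_le : f 0 ≤ 0
  fourier_zero_le : rfourier f 0 ≤ 0

end

/-! Lower bound. If `f` and its transform are nonnegative beyond r₁ and r₂ with r₁r₂ < 0.45², then
rescaling `f` and adding the transform of the rescaled function gives a self-dual F with F(0) ≤ 0
and F ≥ 0 beyond 0.45. By `eq_zero_of_self_dual`, F = 0. The rescaled `f` is then minus its own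
transform and supported in an interval of length 0.9 < 1, so a sup-norm estimate kills it
(`eq_zero_of_anti_self_dual`).

To see F = 0, split F = F⁺ - F⁻ with integrals p and q; then p - q = F(0) ≤ 0. Self-duality at x =
0.45u yields `max_neg_add_integral_le`, which is integrated against `weight` over u in [0,1] and
multiplied by 0.45. On the left F⁻ meets a kernel that is at least 1/2
(`half_le_weight_add_integral`); on the right F⁺ meets a kernel that is at most 0.4995
(`integral_weight_mul_max_le`), and there remains (q - p) times 0.45∫weight < 0.42. Hence q/2 ≤
0.4995p + 0.42(q - p) ≤ 0.4995q, so q = p = 0.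

Upper bound. A Gaussian times a polynomial in 2πx² built from Laguerre polynomials of even index is
self-dual; `extremalPoly` vanishes at 0 and is nonnegative from 2.2169 < 2π·0.594² on, and 0.594² <
0.353. -/

/-! ### Taylor bounds for the cosine -/

/-- The Taylor polynomial of the cosine with `n` terms. -/
noncomputable def cosTaylor (n : ℕ) (t : ℝ) : ℝ :=
  ∑ k ∈ Finset.range n, (-1) ^ k * t ^ (2 * k) / (Nat.factorial (2 * k) : ℝ)

/-- The Taylor polynomial of the sine with `n` terms. -/
noncomputable def sinTaylor (n : ℕ) (t : ℝ) : ℝ :=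
  ∑ k ∈ Finset.range n, (-1) ^ k * t ^ (2 * k + 1) / (Nat.factorial (2 * k + 1) : ℝ)

theorem hasDerivAt_sinTaylor (n : ℕ) (t : ℝ) :
    HasDerivAt (sinTaylor n) (cosTaylor n t) t := by
  unfold sinTaylor cosTaylor
  refine HasDerivAt.fun_sum fun k _ => ?_
  have h := ((hasDerivAt_pow (2 * k + 1) t).const_mul ((-1 : ℝ) ^ k)).div_const
    (Nat.factorial (2 * k + 1) : ℝ)
  refine h.congr_deriv ?_
  rw [Nat.factorial_succ]
  have : (Nat.factorial (2 * k) : ℝ) ≠ 0 := by positivity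
  push_cast
  field_simp

theorem hasDerivAt_cosTaylor (n : ℕ) (t : ℝ) :
    HasDerivAt (cosTaylor (n + 1)) (-sinTaylor n t) t := by
  have hs : cosTaylor (n + 1) = fun t => (∑ k ∈ Finset.range n,
      (-1) ^ (k + 1) * t ^ (2 * k + 2) / (Nat.factorial (2 * k + 2) : ℝ)) + 1 := by
    funext s
    unfold cosTaylor
    rw [Finset.sum_range_succ']
    simp [mul_add]
  rw [hs]
  have hn : -sinTaylor n t = ∑ k ∈ Finset.range n,
      (-1) ^ (k + 1) * t ^ (2 * k + 1) / (Nat.factorial (2 * k + 1) : ℝ) := by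
    unfold sinTaylor
    rw [← Finset.sum_neg_distrib]
    refine Finset.sum_congr rfl fun k _ => ?_
    ring
  rw [hn]
  refine HasDerivAt.add_const _ (HasDerivAt.fun_sum fun k _ => ?_)
  have h := ((hasDerivAt_pow (2 * k + 2) t).const_mul ((-1 : ℝ) ^ (k + 1))).div_const
    (Nat.factorial (2 * k + 2) : ℝ)
  refine h.congr_deriv ?_
  rw [Nat.factorial_succ (2 * k + 1)]
  have : (Nat.factorial (2 * k + 1) : ℝ) ≠ 0 := by positivity
  push_cast
  have h2 : (2 * (k : ℝ) + 1 + 1) ≠ 0 := by positivity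
  have h3 : (2 * (k : ℝ) + 2) ≠ 0 := by positivity
  field_simp
  ring

theorem nonneg_of_hasDerivAt_nonneg {f f' : ℝ → ℝ} (h : ∀ t, HasDerivAt f (f' t) t)
    (h0 : f 0 = 0) (hf' : ∀ t, 0 ≤ t → 0 ≤ f' t) {t : ℝ} (ht : 0 ≤ t) : 0 ≤ f t := by
  have hm : MonotoneOn f (Ici 0) := by
    refine monotoneOn_of_deriv_nonneg (convex_Ici 0)
      (fun x _ => (h x).continuousAt.continuousWithinAt)
      (fun x _ => (h x).differentiableAt.differentiableWithinAt) fun x hx => ?_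
    rw [(h x).deriv]
    rw [interior_Ici] at hx
    exact hf' x hx.le
  have := hm self_mem_Ici (show t ∈ Ici 0 from ht) ht
  rwa [h0] at this

/-- Starting from cos ≤ 1, integration from 0 carries the sign of the cosine remainder to the sine
remainder, and a second integration carries it back reversed. -/
theorem cosTaylor_alternating (n : ℕ) :
    ∀ t : ℝ, 0 ≤ t → 0 ≤ (-1) ^ (n + 1) * (Real.cos t - cosTaylor (n + 1) t) := by
  induction n with
  | zero =>
    intro t _
    have := Real.cos_le_one t
    simp [cosTaylor]
    linarith
  | succ n ih =>
    have hsin : ∀ t : ℝ, 0 ≤ t → 0 ≤ (-1) ^ (n + 1) * (Real.sin t - sinTaylor (n + 1) t) := by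
      intro t ht
      refine nonneg_of_hasDerivAt_nonneg (f := fun t => (-1) ^ (n + 1) *
        (Real.sin t - sinTaylor (n + 1) t)) (fun t => ((Real.hasDerivAt_sin t).sub
          (hasDerivAt_sinTaylor (n + 1) t)).const_mul _) ?_ ih ht
      simp [sinTaylor]
    intro t ht
    refine nonneg_of_hasDerivAt_nonneg (f := fun t => (-1) ^ (n + 1 + 1) *
        (Real.cos t - cosTaylor (n + 1 + 1) t)) (fun t => ((Real.hasDerivAt_cos t).sub
          (hasDerivAt_cosTaylor (n + 1) t)).const_mul _) ?_ ?_ ht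
    · simp [cosTaylor, Finset.sum_range_succ']
    · intro t ht
      have := hsin t ht
      rw [pow_succ]
      linarith

theorem cosTaylor_ten_le_cos {t : ℝ} (ht : 0 ≤ t) : cosTaylor 10 t ≤ Real.cos t := by
  have := cosTaylor_alternating 9 t ht
  norm_num at this
  exact this

theorem cos_le_quartic {t : ℝ} (ht : 0 ≤ t) : Real.cos t ≤ 1 - t ^ 2 / 2 + t ^ 4 / 24 := by
  have := cosTaylor_alternating 2 t ht
  norm_num [cosTaylor, Finset.sum_range_succ, Nat.factorial] at this
  linarith

/-! ### The weight and the kernel bound for the negative part -/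

/-- The weight against which the basic pointwise inequality is integrated. -/
noncomputable def weight (u : ℝ) : ℝ := 1 - 0.2134 * u ^ 2 + 0.0169 * u ^ 4

theorem continuous_weight : Continuous weight := by unfold weight; fun_prop

theorem weight_nonneg {u : ℝ} (h1 : |u| ≤ 1) : 0 ≤ weight u := by
  unfold weight
  have h : u ^ 2 ≤ 1 := (sq_le_one_iff_abs_le_one u).2 h1
  nlinarith [sq_nonneg (u ^ 2)]

theorem integral_weight_mul_pow (n : ℕ) : ∫ u in (0 : ℝ)..1, weight u * u ^ n =
    1 / (n + 1) - 0.2134 / (n + 3) + 0.0169 / (n + 5) := by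
  have h : ∀ u : ℝ, weight u * u ^ n = (u ^ n - 0.2134 * u ^ (n + 2)) + 0.0169 * u ^ (n + 4) := by
    intro u; unfold weight; ring
  simp_rw [h]
  rw [intervalIntegral.integral_add, intervalIntegral.integral_sub,
    intervalIntegral.integral_const_mul, intervalIntegral.integral_const_mul, integral_pow,
    integral_pow, integral_pow]
  · push_cast
    rw [show (n : ℝ) + 2 + 1 = n + 3 by ring, show (n : ℝ) + 4 + 1 = n + 5 by ring]
    simp
    ring
  all_goals exact Continuous.intervalIntegrable (by fun_prop) _ _

theorem integral_weight : ∫ u in (0 : ℝ)..1, weight u = 1 - 0.2134 / 3 + 0.0169 / 5 := by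
  simpa using integral_weight_mul_pow 0

theorem integral_weight_mul_mono {f g : ℝ → ℝ} (hf : Continuous f) (hg : Continuous g)
    (h : ∀ u ∈ Icc (0 : ℝ) 1, f u ≤ g u) :
    ∫ u in (0 : ℝ)..1, weight u * f u ≤ ∫ u in (0 : ℝ)..1, weight u * g u := by
  refine intervalIntegral.integral_mono_on zero_le_one
    ((continuous_weight.mul hf).intervalIntegrable _ _)
    ((continuous_weight.mul hg).intervalIntegrable _ _) fun u hu => ?_
  exact mul_le_mul_of_nonneg_left (h u hu)
    (weight_nonneg (abs_le.2 ⟨by linarith [hu.1], hu.2⟩))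

/-- With the cosine replaced by its quartic upper bound, the difference of the two sides is c₂v² +
c₄v⁴. The coefficients of `weight` are tuned so that c₂ and c₄ are both just nonnegative, whatever v
is. -/
theorem half_le_weight_add_integral (v : ℝ) :
    1 / 2 ≤ weight v / 2 + 0.45 * ∫ u in (0 : ℝ)..1,
      weight u * (1 - Real.cos (2 * Real.pi * 0.45 ^ 2 * u * v)) := by
  set a : ℝ := 2 * Real.pi * 0.45 ^ 2 with ha
  have ha1 : 1.27234 ≤ a := by linarith [Real.pi_gt_d6]
  have ha2 : a ≤ 1.27236 := by linarith [Real.pi_lt_d6]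
  have key : ∫ u in (0 : ℝ)..1, weight u * ((a * v) ^ 2 / 2 * u ^ 2 - (a * v) ^ 4 / 24 * u ^ 4) ≤
      ∫ u in (0 : ℝ)..1, weight u * (1 - Real.cos (a * u * v)) := by
    refine integral_weight_mul_mono (by fun_prop) (by fun_prop) fun u hu => ?_
    have := cos_le_quartic (abs_nonneg (a * u * v))
    rw [Real.cos_abs, sq_abs, Even.pow_abs (by decide)] at this
    linarith
  have hint : ∫ u in (0 : ℝ)..1, weight u * ((a * v) ^ 2 / 2 * u ^ 2 - (a * v) ^ 4 / 24 * u ^ 4) =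
      (a * v) ^ 2 / 2 * (1 / 3 - 0.2134 / 5 + 0.0169 / 7)
        - (a * v) ^ 4 / 24 * (1 / 5 - 0.2134 / 7 + 0.0169 / 9) := by
    have h2 := integral_weight_mul_pow 2
    have h4 := integral_weight_mul_pow 4
    norm_num at h2 h4
    rw [show (fun u : ℝ => weight u * ((a * v) ^ 2 / 2 * u ^ 2 - (a * v) ^ 4 / 24 * u ^ 4)) =
      fun u => (a * v) ^ 2 / 2 * (weight u * u ^ 2) - (a * v) ^ 4 / 24 * (weight u * u ^ 4) by
        funext u; ring]
    rw [intervalIntegral.integral_sub, intervalIntegral.integral_const_mul,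
      intervalIntegral.integral_const_mul, h2, h4]
    · norm_num
    all_goals
      exact Continuous.intervalIntegrable
        (continuous_const.mul (continuous_weight.mul (by fun_prop))) _ _
  rw [hint] at key
  have a2 : 1.61884 ≤ a ^ 2 := by nlinarith
  have a2' : a ^ 2 ≤ 1.6189 := by nlinarith
  have a4 : a ^ 4 ≤ 2.62084 := by
    have : a ^ 4 = a ^ 2 * a ^ 2 := by ring
    nlinarith
  have hv2 : 0 ≤ v ^ 2 := sq_nonneg v
  have hv4 : 0 ≤ v ^ 4 := by positivity
  have e2 : (a * v) ^ 2 = a ^ 2 * v ^ 2 := by ring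
  have e4 : (a * v) ^ 4 = a ^ 4 * v ^ 4 := by ring
  rw [e2, e4] at key
  have b2 : 1.61884 * v ^ 2 ≤ a ^ 2 * v ^ 2 := mul_le_mul_of_nonneg_right a2 hv2
  have b4 : a ^ 4 * v ^ 4 ≤ 2.62084 * v ^ 4 := mul_le_mul_of_nonneg_right a4 hv4
  have hw : weight v = 1 - 0.2134 * v ^ 2 + 0.0169 * v ^ 4 := rfl
  rw [hw]
  norm_num at key b2 b4 ⊢
  linarith

/-! ### The kernel bound for the positive part -/

/-- An upper bound for `0.45 * ∫ u in 0..1, weight u * (1 - cos (√z * u))`. -/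
noncomputable def weightedTaylor (z : ℝ) : ℝ :=
  0.45 * ((-1) ^ 2 / 2 * (1 / 3 - 0.2134 / 5 + 0.0169 / 7) * z ^ 1 + (-1) ^ 3 / 24 * (1 / 5 - 0.2134 / 7 + 0.0169 / 9) * z ^ 2
      + (-1) ^ 4 / 720 * (1 / 7 - 0.2134 / 9 + 0.0169 / 11) * z ^ 3 + (-1) ^ 5 / 40320 * (1 / 9 - 0.2134 / 11 + 0.0169 / 13) * z ^ 4
      + (-1) ^ 6 / 3628800 * (1 / 11 - 0.2134 / 13 + 0.0169 / 15) * z ^ 5 + (-1) ^ 7 / 479001600 * (1 / 13 - 0.2134 / 15 + 0.0169 / 17) * z ^ 6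
      + (-1) ^ 8 / 87178291200 * (1 / 15 - 0.2134 / 17 + 0.0169 / 19) * z ^ 7 + (-1) ^ 9 / 20922789888000 * (1 / 17 - 0.2134 / 19 + 0.0169 / 21) * z ^ 8
      + (-1) ^ 10 / 6402373705728000 * (1 / 19 - 0.2134 / 21 + 0.0169 / 23) * z ^ 9)

/-- The difference has degree 9 in z, and its Bernstein coefficients on the interval are all
positive. The next two bounds use the same certificate on other intervals. -/
theorem weightedTaylor_le_of_le_sixteen {z : ℝ} (h1 : 0 ≤ z) (h2 : z ≤ 16) :
    weightedTaylor z ≤ 0.4995 := by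
  have hz : 0 ≤ z := by linarith
  have hz' : 0 ≤ 16 - z := by linarith
  have h : 0 ≤ 999 / 137438953472000 * z ^ 0 * (16 - z) ^ 9 +
      6020799 / 120259084288000000 * z ^ 1 * (16 - z) ^ 8 +
      13603189 / 90194313216000000 * z ^ 2 * (16 - z) ^ 7 +
      773847563 / 2976412336128000000 * z ^ 3 * (16 - z) ^ 6 +
      1675781189 / 5952824672256000000 * z ^ 4 * (16 - z) ^ 5 +
      1146446873441 / 5804004055449600000000 * z ^ 5 * (16 - z) ^ 4 +
      13207603075441 / 148002103413964800000000 * z ^ 6 * (16 - z) ^ 3 +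
      8890944344453 / 357895995528314880000000 * z ^ 7 * (16 - z) ^ 2 +
      10160820135379 / 2645567198945303592960000 * z ^ 8 * (16 - z) ^ 1 +
      3450895578847271 / 13690810254541946093568000000 * z ^ 9 * (16 - z) ^ 0 := by positivity
  unfold weightedTaylor
  refine le_of_sub_nonneg (h.trans_eq ?_)
  ring

theorem weightedTaylor_le_of_sixteen_le {z : ℝ} (h1 : 16 ≤ z) (h2 : z ≤ 25.2) :
    weightedTaylor z ≤ 0.4995 := by
  have hz : 0 ≤ z - 16 := by linarith
  have hz' : 0 ≤ 25.2 - z := by linarith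
  have h : 0 ≤ 431361947355908875 / 11758441604401187272263278592 * (z - 16) ^ 0 * (25.2 - z) ^ 9 +
      1037869689712384975 / 5225974046400527676561457152 * (z - 16) ^ 1 * (25.2 - z) ^ 8 +
      209864125763804503 / 497711813942907397767757824 * (z - 16) ^ 2 * (25.2 - z) ^ 7 +
      2146701374037743 / 5049835774583070188390400 * (z - 16) ^ 3 * (25.2 - z) ^ 6 +
      2396887002544204199 / 11850281284354938042089472000 * (z - 16) ^ 4 * (25.2 - z) ^ 5 +
      5558484190518643 / 49376172018145575175372800 * (z - 16) ^ 5 * (25.2 - z) ^ 4 +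
      760133854427124131 / 3590994328592405467299840000 * (z - 16) ^ 6 * (25.2 - z) ^ 3 +
      139527740408393011 / 633027846386481733017600000 * (z - 16) ^ 7 * (25.2 - z) ^ 2 +
      40858354484896251579 / 398999369843600607477760000000 * (z - 16) ^ 8 * (25.2 - z) ^ 1 +
      641184928642250217 / 35624943736035768524800000000 * (z - 16) ^ 9 * (25.2 - z) ^ 0 := by positivity
  unfold weightedTaylor
  refine le_of_sub_nonneg (h.trans_eq ?_)
  ring

/-- Serves θ between 5 and 6, with z = θ². The extra term is the sixth moment of `weight` times a
bound, linear in z, for the ε of `max_one_sub_cos_le_add`. -/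
theorem weightedTaylor_add_le {z : ℝ} (h1 : 25 ≤ z) (h2 : z ≤ 36) :
    weightedTaylor z + 0.45 * (1 / 7 - 0.2134 / 9 + 0.0169 / 11) * (z / 11.5 - 2.13582) ≤ 0.4995 := by
  have hz : 0 ≤ z - 25 := by linarith
  have hz' : 0 ≤ 36 - z := by linarith
  have h : 0 ≤ 11191874581362286186957 / 4527458643578964689756160000000000 * (z - 25) ^ 0 * (36 - z) ^ 9 +
      59705920567334749935697 / 4275933163380133318103040000000000 * (z - 25) ^ 1 * (36 - z) ^ 8 +
      3316881413383015004381 / 89081940903752777460480000000000 * (z - 25) ^ 2 * (36 - z) ^ 7 +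
      438420283437395901251 / 6362995778839484104320000000000 * (z - 25) ^ 3 * (36 - z) ^ 6 +
      55042039290358706797 / 530249648236623675360000000000 * (z - 25) ^ 4 * (36 - z) ^ 5 +
      67243432070894617 / 548912679333978960000000000 * (z - 25) ^ 5 * (36 - z) ^ 4 +
      1117096933663770701 / 11046867671596326570000000000 * (z - 25) ^ 6 * (36 - z) ^ 3 +
      680539737494979463 / 12888012283529047665000000000 * (z - 25) ^ 7 * (36 - z) ^ 2 +
      132821840202864223 / 8592008189019365110000000000 * (z - 25) ^ 8 * (36 - z) ^ 1 +
      16499871567263247 / 8592008189019365110000000000 * (z - 25) ^ 9 * (36 - z) ^ 0 := by positivity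
  unfold weightedTaylor
  refine le_of_sub_nonneg (h.trans_eq ?_)
  ring

theorem integral_weight_mul_one_sub_cos_le {θ : ℝ} (hθ : 0 ≤ θ) :
    0.45 * ∫ u in (0 : ℝ)..1, weight u * (1 - Real.cos (θ * u)) ≤ weightedTaylor (θ ^ 2) := by
  have hc : Continuous (cosTaylor 10) := by unfold cosTaylor; fun_prop
  have h1 : ∫ u in (0 : ℝ)..1, weight u * (1 - Real.cos (θ * u)) ≤
      ∫ u in (0 : ℝ)..1, weight u * (1 - cosTaylor 10 (θ * u)) := by
    refine integral_weight_mul_mono (by fun_prop)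
      (continuous_const.sub (hc.comp (by fun_prop))) fun u hu => ?_
    linarith [cosTaylor_ten_le_cos (mul_nonneg hθ hu.1)]
  have h2 : ∫ u in (0 : ℝ)..1, weight u * (1 - cosTaylor 10 (θ * u)) =
      ∑ k ∈ Finset.range 9, (-1) ^ k * (θ ^ 2) ^ (k + 1) / (Nat.factorial (2 * (k + 1)) : ℝ) *
        ∫ u in (0 : ℝ)..1, weight u * u ^ (2 * (k + 1)) := by
    simp_rw [← intervalIntegral.integral_const_mul]
    rw [← intervalIntegral.integral_finsetSum]
    · congr 1
      funext u
      unfold cosTaylor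
      rw [Finset.sum_range_succ', ← sub_sub, mul_sub, mul_sub, Finset.mul_sum]
      simp only [pow_zero, mul_zero, Nat.factorial_zero, Nat.cast_one, div_one, mul_one]
      rw [sub_right_comm, sub_self, zero_sub, ← Finset.sum_neg_distrib]
      refine Finset.sum_congr rfl fun k _ => ?_
      rw [mul_pow]
      ring
    · intro k _
      exact Continuous.intervalIntegrable
        (continuous_const.mul (continuous_weight.mul (by fun_prop))) _ _
  refine (mul_le_mul_of_nonneg_left h1 (by norm_num)).trans_eq ?_
  rw [h2]
  simp_rw [integral_weight_mul_pow]
  simp only [Finset.sum_range_succ, Finset.sum_range_zero, weightedTaylor]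
  norm_num [Nat.factorial]
  ring

/-- The excess of the maximum of `1 - cos (θu)` and `1 - cos (au)` over the first of the two. -/
theorem max_one_sub_cos_le_add {a θ ε u : ℝ} (ha : 0 ≤ a) (haθ : a ≤ θ) (ha' : a ≤ Real.pi)
    (hε : 0 ≤ ε) (hε1 : ε ≤ 1) (hεθ : θ + a - 2 * Real.pi ≤ ε) (hu : u ∈ Icc (0 : ℝ) 1) :
    max (1 - Real.cos (θ * u)) (1 - Real.cos (a * u)) ≤ 1 - Real.cos (θ * u) + ε * u ^ 6 := by
  have hu6 : 0 ≤ ε * u ^ 6 := mul_nonneg hε (pow_nonneg hu.1 6)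
  refine max_le (by linarith) ?_
  have hau : 0 ≤ a * u := mul_nonneg ha hu.1
  have haθu : a * u ≤ θ * u := mul_le_mul_of_nonneg_right haθ hu.1
  have haπ : a * u ≤ Real.pi := by nlinarith [hu.1, hu.2]
  -- Up to this threshold θu, reflected to 2π - θu if it exceeds π, stays to the right of au within
  -- [0,π], so there is no excess. Beyond it the excess is at most δ, by the product formula for a
  -- difference of cosines.
  by_cases h : θ * u + a * u ≤ 2 * Real.pi
  · have hcos : Real.cos (θ * u) ≤ Real.cos (a * u) := by
      rcases le_total (θ * u) Real.pi with h1 | h1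
      · exact Real.cos_le_cos_of_nonneg_of_le_pi hau h1 haθu
      · rw [← Real.cos_two_pi_sub (θ * u)]
        exact Real.cos_le_cos_of_nonneg_of_le_pi hau (by linarith) (by linarith)
    linarith
  · push Not at h
    set δ := θ * u + a * u - 2 * Real.pi with hδ
    have hd : Real.cos (θ * u) - Real.cos (a * u) ≤ δ := by
      rw [← Real.cos_two_pi_sub (θ * u)]
      have := Real.cos_sub_cos (2 * Real.pi - θ * u) (a * u)
      rw [this]
      have h1 : |Real.sin ((2 * Real.pi - θ * u - a * u) / 2)| ≤ δ / 2 := by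
        refine Real.abs_sin_le_abs.trans_eq ?_
        rw [abs_of_neg (by linarith)]
        rw [hδ]; ring
      have h2 := Real.abs_sin_le_one ((2 * Real.pi - θ * u + a * u) / 2)
      have h3 := abs_le.1 ((abs_mul (Real.sin ((2 * Real.pi - θ * u + a * u) / 2))
        (Real.sin ((2 * Real.pi - θ * u - a * u) / 2))).le.trans
          (mul_le_mul h2 h1 (abs_nonneg _) zero_le_one))
      linarith [h3.1]
    -- Here δ ≤ ε - (ε + 2π)(1 - u), while Bernoulli gives εu⁶ ≥ ε - 6ε(1 - u); the exponent 6 is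
    -- allowed because 5ε ≤ 2π.
    have hb : δ ≤ ε * u ^ 6 := by
      have hbern : 1 + 6 * (u - 1) ≤ u ^ 6 := by
        have := one_add_mul_le_pow (show (-2 : ℝ) ≤ u - 1 by linarith [hu.1]) 6
        norm_num at this
        linarith
      have h1 : ε * (1 + 6 * (u - 1)) ≤ ε * u ^ 6 := mul_le_mul_of_nonneg_left hbern hε
      have h2 : δ ≤ ε * u - 2 * Real.pi * (1 - u) := by
        rw [hδ]
        nlinarith [mul_le_mul_of_nonneg_right hεθ hu.1]
      nlinarith [Real.pi_gt_three, hu.2]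
    linarith

/-- The convex function z ↦ max(z, L) lies below its chord from (0, L) to (2, 2). -/
theorem max_le_chord {z K L : ℝ} (hz : 0 ≤ z) (hz2 : z ≤ 2) (hKL : K ≤ L) (hL : 0 ≤ L)
    (hL2 : L ≤ 2) : max z K ≤ L + (1 - L / 2) * z :=
  max_le (by nlinarith) (by nlinarith)

/-- The amplitude of the oscillating term in the chord bound. -/
noncomputable def chordWeight (u : ℝ) : ℝ := weight u * (1 - 0.8095 * u ^ 2 / 2)

/-- Repeated integration by parts, which terminates because `chordWeight` is a polynomial of degree
6; the numerators are its derivatives at 1, up to sign. -/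
theorem integral_chordWeight_mul_cos {θ : ℝ} (hθ : θ ≠ 0) :
    ∫ u in (0 : ℝ)..1, chordWeight u * Real.cos (θ * u) =
      (0.478283375 / θ + 0.20222445 / θ ^ 3 + 0.0160686 / θ ^ 5 + 4.924998 / θ ^ 7) * Real.sin θ -
      (0.86424705 / θ ^ 2 + 1.6577346 / θ ^ 4 + 4.924998 / θ ^ 6) * Real.cos θ := by
  have hderiv : ∀ u : ℝ, HasDerivAt (fun u : ℝ =>
      ((1 - 0.61815 * u ^ 2 + 0.10327365 * u ^ 4 - 0.006840275 * u ^ 6) / θ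
        - (-1.2363 + 1.2392838 * u ^ 2 - 0.20520825 * u ^ 4) / θ ^ 3
        + (2.4785676 - 2.462499 * u ^ 2) / θ ^ 5 + 4.924998 / θ ^ 7) * Real.sin (θ * u)
      + ((-1.2363 * u + 0.4130946 * u ^ 3 - 0.04104165 * u ^ 5) / θ ^ 2
        - (2.4785676 * u - 0.820833 * u ^ 3) / θ ^ 4
        - 4.924998 * u / θ ^ 6) * Real.cos (θ * u))
      (chordWeight u * Real.cos (θ * u)) u := by
    intro u
    have hp : ∀ n : ℕ, HasDerivAt (fun u : ℝ => u ^ n) (n * u ^ (n - 1)) u :=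
      fun n => hasDerivAt_pow n u
    have hs : HasDerivAt (fun u : ℝ => Real.sin (θ * u)) (Real.cos (θ * u) * θ) u := by
      simpa using ((hasDerivAt_id u).const_mul θ).sin
    have hc : HasDerivAt (fun u : ℝ => Real.cos (θ * u)) (-Real.sin (θ * u) * θ) u := by
      simpa using ((hasDerivAt_id u).const_mul θ).cos
    have hP := (((((((hp 2).const_mul (0.61815 : ℝ)).const_sub 1).add
      ((hp 4).const_mul (0.10327365 : ℝ))).sub ((hp 6).const_mul (0.006840275 : ℝ))).div_const θ).sub
      (((((hp 2).const_mul (1.2392838 : ℝ)).const_add (-1.2363)).sub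
        ((hp 4).const_mul (0.20520825 : ℝ))).div_const (θ ^ 3))).add
      ((((hp 2).const_mul (2.462499 : ℝ)).const_sub 2.4785676).div_const (θ ^ 5)) |>.add_const
        (4.924998 / θ ^ 7)
    have hQ := ((((((hasDerivAt_id u).const_mul (-1.2363 : ℝ)).add
      ((hp 3).const_mul (0.4130946 : ℝ))).sub ((hp 5).const_mul (0.04104165 : ℝ))).div_const
        (θ ^ 2)).sub ((((hasDerivAt_id u).const_mul (2.4785676 : ℝ)).sub
          ((hp 3).const_mul (0.820833 : ℝ))).div_const (θ ^ 4))).sub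
      (((hasDerivAt_id u).const_mul (4.924998 : ℝ)).div_const (θ ^ 6))
    refine ((hP.mul hs).add (hQ.mul hc)).congr_deriv ?_
    simp only [id, chordWeight, weight, Pi.add_apply, Pi.sub_apply]
    field_simp
    norm_num
    ring
  rw [intervalIntegral.integral_eq_sub_of_hasDerivAt (fun u _ => hderiv u)]
  · simp only [mul_one, mul_zero, Real.sin_zero, Real.cos_zero]
    norm_num
    ring
  · exact Continuous.intervalIntegrable (by unfold chordWeight weight; fun_prop) _ _

theorem neg_integral_chordWeight_mul_cos_le {θ : ℝ} (hθ : 6 ≤ θ) :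
    -∫ u in (0 : ℝ)..1, chordWeight u * Real.cos (θ * u) ≤ 0.059 := by
  have h0 : 0 < θ := by linarith
  rw [integral_chordWeight_mul_cos h0.ne']
  set p := 0.478283375 / θ + 0.20222445 / θ ^ 3 + 0.0160686 / θ ^ 5 + 4.924998 / θ ^ 7 with hp
  set q := 0.86424705 / θ ^ 2 + 1.6577346 / θ ^ 4 + 4.924998 / θ ^ 6 with hq
  set t := θ⁻¹ with ht
  have ht0 : 0 < t := inv_pos.2 h0
  have ht6 : t ≤ 1 / 6 := by
    rw [ht, inv_eq_one_div]; exact one_div_le_one_div_of_le (by norm_num) hθ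
  have ht2 : t ^ 2 ≤ 1 / 36 := by nlinarith
  have hpt : p = t * (0.478283375 + 0.20222445 * t ^ 2 + 0.0160686 * t ^ 4 + 4.924998 * t ^ 6) := by
    rw [hp, ht]; field_simp
  have hqt : q = t ^ 2 * (0.86424705 + 1.6577346 * t ^ 2 + 4.924998 * t ^ 4) := by
    rw [hq, ht]; field_simp
  have ht4 : t ^ 4 ≤ 1 / 1296 := by
    have : t ^ 4 = t ^ 2 * t ^ 2 := by ring
    nlinarith [sq_nonneg t]
  have htt6 : t ^ 6 ≤ 1 / 46656 := by
    have : t ^ 6 = t ^ 4 * t ^ 2 := by ring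
    have h4 : 0 ≤ t ^ 4 := by positivity
    nlinarith [sq_nonneg t]
  clear_value t
  have hp0 : 0 ≤ p := by positivity
  have hq0 : 0 ≤ q := by positivity
  have hp1 : p ≤ 0.4842 * t := by
    rw [hpt, mul_comm]
    exact mul_le_mul_of_nonneg_right (by linarith) ht0.le
  have hq1 : q ≤ 0.9142 * t ^ 2 := by
    rw [hqt, mul_comm]
    exact mul_le_mul_of_nonneg_right (by linarith) (sq_nonneg t)
  clear_value p q
  -- On [6, 2π] the sine is only slightly negative and on [2π, 3π] it is nonnegative; beyond 3π the
  -- amplitude √(p² + q²) is already small enough.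
  rcases le_or_gt θ (2 * Real.pi) with h2 | h2
  · have hsin : -0.2832 ≤ Real.sin θ := by
      have := Real.sin_le (show 0 ≤ 2 * Real.pi - θ by linarith)
      rw [Real.sin_two_pi_sub] at this
      linarith [Real.pi_lt_d4]
    nlinarith [Real.cos_le_one θ]
  rcases le_or_gt θ (3 * Real.pi) with h3 | h3
  · have hsin : 0 ≤ Real.sin θ := by
      rw [← Real.sin_sub_two_pi]
      exact Real.sin_nonneg_of_nonneg_of_le_pi (by linarith) (by linarith)
    nlinarith [Real.cos_le_one θ]
  · have ht9 : t ≤ 1 / 9.42 := by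
      rw [ht, inv_eq_one_div]
      exact one_div_le_one_div_of_le (by norm_num) (by linarith [Real.pi_gt_d2])
    have hp2 : p ≤ 0.0515 := by linarith
    have hq2 : q ≤ 0.0104 := by nlinarith
    have hsq : (q * Real.cos θ - p * Real.sin θ) ^ 2 ≤ (0.059 : ℝ) ^ 2 := by
      have hpp : p ^ 2 ≤ 0.0515 ^ 2 := pow_le_pow_left₀ hp0 hp2 2
      have hqq : q ^ 2 ≤ 0.0104 ^ 2 := pow_le_pow_left₀ hq0 hq2 2
      have hid : (q * Real.cos θ - p * Real.sin θ) ^ 2 +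
          (p * Real.cos θ + q * Real.sin θ) ^ 2 = p ^ 2 + q ^ 2 := by
        have h1 : (q * Real.cos θ - p * Real.sin θ) ^ 2 +
          (p * Real.cos θ + q * Real.sin θ) ^ 2 =
            (p ^ 2 + q ^ 2) * (Real.sin θ ^ 2 + Real.cos θ ^ 2) := by ring
        rw [h1, Real.sin_sq_add_cos_sq, mul_one]
      have h0 := sq_nonneg (p * Real.cos θ + q * Real.sin θ)
      norm_num at hpp hqq ⊢
      linarith
    have := (abs_le.1 (abs_le_of_sq_le_sq hsq (by norm_num))).2
    linarith

/-- For θ ≤ a both terms lie below 0.8095u², since a²/2 ≤ 0.8095. For a ≤ θ ≤ 6 the maximum is the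
first term up to a small excess, and Taylor bounds apply. For θ ≥ 6 the chord bound makes the
integrand affine in cos(θu), whose integral is small by oscillation. -/
theorem integral_weight_mul_max_le {θ : ℝ} (hθ : 0 ≤ θ) :
    0.45 * ∫ u in (0 : ℝ)..1, weight u *
      max (1 - Real.cos (θ * u)) (1 - Real.cos (2 * Real.pi * 0.45 ^ 2 * u)) ≤ 0.4995 := by
  set a : ℝ := 2 * Real.pi * 0.45 ^ 2 with ha
  have ha1 : 1.27234 ≤ a := by linarith [Real.pi_gt_d6]
  have ha2 : a ≤ 1.27236 := by linarith [Real.pi_lt_d6]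
  have haπ : a ≤ Real.pi := by linarith [Real.pi_gt_three]
  have hsq : ∀ u : ℝ, 1 - Real.cos (a * u) ≤ 0.8095 * u ^ 2 := fun u => by
    have h1 := Real.one_sub_sq_div_two_le_cos (x := a * u)
    have h2 : a ^ 2 ≤ 1.619 := by nlinarith
    nlinarith [sq_nonneg u]
  have h45 : (0 : ℝ) ≤ 0.45 := by norm_num
  rcases le_total θ a with h1 | h1
  · have h : ∫ u in (0 : ℝ)..1, weight u *
        max (1 - Real.cos (θ * u)) (1 - Real.cos (a * u)) ≤
        ∫ u in (0 : ℝ)..1, weight u * (0.8095 * u ^ 2) := by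
      refine integral_weight_mul_mono (by fun_prop) (by fun_prop) fun u hu => ?_
      refine max_le (le_trans ?_ (hsq u)) (hsq u)
      have := Real.cos_le_cos_of_nonneg_of_le_pi (mul_nonneg hθ hu.1)
        (show a * u ≤ Real.pi by nlinarith [hu.1, hu.2]) (mul_le_mul_of_nonneg_right h1 hu.1)
      linarith
    have h2 := integral_weight_mul_pow 2
    norm_num at h2
    simp_rw [mul_left_comm (weight _)] at h
    rw [intervalIntegral.integral_const_mul, h2] at h
    norm_num at h ⊢
    linarith
  rcases le_total θ 6 with h6 | h6
  · have hz := integral_weight_mul_one_sub_cos_le hθ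
    have hbound : ∀ ε : ℝ, 0 ≤ ε → ε ≤ 1 → θ + a - 2 * Real.pi ≤ ε →
        0.45 * ∫ u in (0 : ℝ)..1, weight u *
          max (1 - Real.cos (θ * u)) (1 - Real.cos (a * u)) ≤
        weightedTaylor (θ ^ 2) + 0.45 * (1 / 7 - 0.2134 / 9 + 0.0169 / 11) * ε := by
      intro ε hε hε1 hεθ
      have h : ∫ u in (0 : ℝ)..1, weight u *
          max (1 - Real.cos (θ * u)) (1 - Real.cos (a * u)) ≤
          ∫ u in (0 : ℝ)..1, weight u * (1 - Real.cos (θ * u) + ε * u ^ 6) :=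
        integral_weight_mul_mono (by fun_prop) (by fun_prop) fun u hu =>
          max_one_sub_cos_le_add (by linarith) h1 haπ hε hε1 hεθ hu
      have h6 := integral_weight_mul_pow 6
      norm_num at h6
      simp_rw [mul_add, mul_left_comm (weight _) ε] at h
      rw [intervalIntegral.integral_add, intervalIntegral.integral_const_mul, h6] at h
      · norm_num at h hz ⊢
        linarith
      all_goals
        exact Continuous.intervalIntegrable (by unfold weight; fun_prop) _ _
    rcases le_total (θ + a - 2 * Real.pi) 0 with hneg | hpos
    · have hb := hbound 0 le_rfl zero_le_one hneg
      rw [mul_zero, add_zero] at hb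
      refine hb.trans ?_
      rcases le_total (θ ^ 2) 16 with h16 | h16
      · exact weightedTaylor_le_of_le_sixteen (by positivity) h16
      · refine weightedTaylor_le_of_sixteen_le h16 ?_
        nlinarith [Real.pi_lt_d6]
    · have hθ5 : 5.0108 ≤ θ := by linarith [Real.pi_gt_d6]
      refine (hbound _ hpos (by linarith [Real.pi_gt_d6]) le_rfl).trans ?_
      refine le_trans ?_ (weightedTaylor_add_le (z := θ ^ 2) (by nlinarith) (by nlinarith))
      -- The tangent to θ² at 5.75 makes ε linear in z = θ².
      have : θ + a - 2 * Real.pi ≤ θ ^ 2 / 11.5 - 2.13582 := by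
        have := sq_nonneg (θ - 5.75)
        norm_num
        linarith [Real.pi_gt_d6]
      gcongr
  · have h : ∫ u in (0 : ℝ)..1, weight u *
        max (1 - Real.cos (θ * u)) (1 - Real.cos (a * u)) ≤
        ∫ u in (0 : ℝ)..1, weight u *
          (0.8095 * u ^ 2 + (1 - 0.8095 * u ^ 2 / 2) * (1 - Real.cos (θ * u))) := by
      refine integral_weight_mul_mono (by fun_prop) (by fun_prop) fun u hu => ?_
      refine max_le_chord (by linarith [Real.cos_le_one (θ * u)])
        (by linarith [Real.neg_one_le_cos (θ * u)]) (hsq u) (by positivity) ?_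
      nlinarith [hu.1, hu.2]
    have hsplit : ∀ u : ℝ, weight u *
          (0.8095 * u ^ 2 + (1 - 0.8095 * u ^ 2 / 2) * (1 - Real.cos (θ * u))) =
        weight u + 0.40475 * (weight u * u ^ 2) - chordWeight u * Real.cos (θ * u) := by
      intro u; unfold chordWeight; ring
    have hcc : Continuous chordWeight := by unfold chordWeight weight; fun_prop
    have hw := continuous_weight
    have h2 := integral_weight_mul_pow 2
    norm_num at h2
    simp_rw [hsplit] at h
    rw [intervalIntegral.integral_sub, intervalIntegral.integral_add,
      intervalIntegral.integral_const_mul, h2, integral_weight] at h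
    · have h3 := neg_integral_chordWeight_mul_cos_le h6
      norm_num at h h3 ⊢
      linarith
    all_goals exact Continuous.intervalIntegrable (by fun_prop) _ _

/-! ### Vanishing of self-dual functions -/

section WeightedFubini

variable {φ : ℝ → ℝ} {k : ℝ → ℝ → ℝ} {C : ℝ}

theorem integrable_mul_of_bounded (hφ : Integrable φ) (hk : Continuous (Function.uncurry k))
    (hC : ∀ y u, |k y u| ≤ C) (u : ℝ) : Integrable fun y => φ y * k y u :=
  hφ.mul_bdd (c := C) (Continuous.aestronglyMeasurable (by fun_prop)) (ae_of_all _ fun y => hC y u)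

theorem continuous_integral_mul (hφ : Integrable φ) (hk : Continuous (Function.uncurry k))
    (hC : ∀ y u, |k y u| ≤ C) : Continuous fun u => ∫ y, φ y * k y u := by
  refine continuous_of_dominated (bound := fun y => ‖φ y‖ * C)
    (fun u => (integrable_mul_of_bounded hφ hk hC u).aestronglyMeasurable) ?_
    (hφ.norm.mul_const C) (ae_of_all _ fun y => by fun_prop)
  intro u
  refine ae_of_all _ fun y => ?_
  rw [norm_mul]
  exact mul_le_mul_of_nonneg_left (hC y u) (norm_nonneg _)

theorem integral_weight_mul_integral (hφ : Integrable φ) (hk : Continuous (Function.uncurry k))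
    (hC : ∀ y u, |k y u| ≤ C) :
    ∫ u in (0 : ℝ)..1, weight u * ∫ y, φ y * k y u =
      ∫ y, φ y * ∫ u in (0 : ℝ)..1, weight u * k y u := by
  have hw := continuous_weight
  simp_rw [← integral_const_mul, ← intervalIntegral.integral_const_mul,
    intervalIntegral.integral_of_le zero_le_one]
  rw [integral_integral_swap]
  · congr 1; funext y; congr 1; funext u; ring
  · have h1 : Integrable (fun u => weight u) (volume.restrict (Ioc (0 : ℝ) 1)) :=
      (hw.integrableOn_Icc).mono_set Ioc_subset_Icc_self
    have h2 := (h1.mul_prod hφ).mul_bdd (g := fun z : ℝ × ℝ => k z.2 z.1)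
      (c := C)
      (Continuous.aestronglyMeasurable (by fun_prop)) (ae_of_all _ fun z => hC z.2 z.1)
    refine h2.congr (ae_of_all _ fun z => ?_)
    simp only [Function.uncurry]
    ring

end WeightedFubini

theorem integrable_mul_cos {φ : ℝ → ℝ} (hφ : Integrable φ) (x : ℝ) :
    Integrable fun y => φ y * Real.cos (2 * Real.pi * x * y) :=
  hφ.mul_bdd (c := 1) (Continuous.aestronglyMeasurable (by fun_prop))
    (ae_of_all _ fun y => Real.abs_cos_le_one _)

/-- Self-duality reads -F(x) + ∫F⁻(1 - cos) = ∫F⁺(1 - cos) + (q - p) at x = 0.45u, which settles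
F(x) ≤ 0. If F(x) ≥ 0, use that 1 - cos ≤ κ on the support of F⁻: the left side is at most κq ≤ κp +
(q - p), since κ ≤ 1 and p ≤ q. The maximum with κ on the right absorbs κp. -/
theorem max_neg_add_integral_le {F : ℝ → ℝ} (hF : Integrable F)
    (hself : ∀ x, F x = ∫ y, F y * Real.cos (2 * Real.pi * x * y)) (hF0 : F 0 ≤ 0)
    (hpos : ∀ x, 0.45 < |x| → 0 ≤ F x) {u : ℝ} (hu : u ∈ Icc (0 : ℝ) 1) :
    max (-F (0.45 * u)) 0 + ∫ y, max (-F y) 0 * (1 - Real.cos (2 * Real.pi * 0.45 * y * u)) ≤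
      (∫ y, max (F y) 0 * max (1 - Real.cos (2 * Real.pi * 0.45 * y * u))
        (1 - Real.cos (2 * Real.pi * 0.45 ^ 2 * u))) +
        ((∫ y, max (-F y) 0) - ∫ y, max (F y) 0) := by
  have hc : ∀ y, Real.cos (2 * Real.pi * 0.45 * y * u) =
      Real.cos (2 * Real.pi * (0.45 * u) * y) := fun y => by ring_nf
  simp_rw [hc]
  set x := 0.45 * u with hx
  set κ := 1 - Real.cos (2 * Real.pi * 0.45 ^ 2 * u) with hκ
  have hg := hF.neg_part
  have hh := hF.pos_part
  have hFgh : ∀ y, F y = max (F y) 0 - max (-F y) 0 := fun y => by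
    rcases le_total (F y) 0 with h | h
    · rw [max_eq_right h, max_eq_left (by linarith)]; ring
    · rw [max_eq_left h, max_eq_right (by linarith)]; ring
  have hint0 : F 0 = (∫ y, max (F y) 0) - ∫ y, max (-F y) 0 := by
    rw [← integral_sub hh hg, hself 0]
    refine integral_congr_ae (ae_of_all _ fun y => ?_)
    simp [← hFgh]
  have hpq : (∫ y, max (F y) 0) ≤ ∫ y, max (-F y) 0 := by linarith
  have hFx : F x = (∫ y, max (F y) 0 * Real.cos (2 * Real.pi * x * y)) -
      ∫ y, max (-F y) 0 * Real.cos (2 * Real.pi * x * y) := by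
    rw [← integral_sub (integrable_mul_cos hh x) (integrable_mul_cos hg x), hself x]
    refine integral_congr_ae (ae_of_all _ fun y => ?_)
    beta_reduce
    rw [← sub_mul, ← hFgh]
  have hmint : Integrable fun y => max (F y) 0 * max (1 - Real.cos (2 * Real.pi * x * y)) κ := by
    refine hh.mul_bdd (c := 2 + |κ|) (Continuous.aestronglyMeasurable (by fun_prop))
      (ae_of_all _ fun y => abs_le.2 ⟨?_, ?_⟩)
    · exact le_max_of_le_left (by linarith [Real.cos_le_one (2 * Real.pi * x * y), abs_nonneg κ])
    · exact max_le (by linarith [Real.neg_one_le_cos (2 * Real.pi * x * y), abs_nonneg κ])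
        (by linarith [le_abs_self κ])
  have h1c : ∀ {φ : ℝ → ℝ}, Integrable φ →
      Integrable fun y => φ y * (1 - Real.cos (2 * Real.pi * x * y)) := fun h => by
    simp_rw [mul_sub, mul_one]
    exact h.sub (integrable_mul_cos h x)
  have hG : ∫ y, max (-F y) 0 * (1 - Real.cos (2 * Real.pi * x * y)) =
      (∫ y, max (-F y) 0) - ∫ y, max (-F y) 0 * Real.cos (2 * Real.pi * x * y) := by
    rw [← integral_sub hg (integrable_mul_cos hg x)]
    congr 1; funext y; ring
  have hH : ∫ y, max (F y) 0 * (1 - Real.cos (2 * Real.pi * x * y)) =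
      (∫ y, max (F y) 0) - ∫ y, max (F y) 0 * Real.cos (2 * Real.pi * x * y) := by
    rw [← integral_sub hh (integrable_mul_cos hh x)]
    congr 1; funext y; ring
  have hm1 : ∫ y, max (F y) 0 * (1 - Real.cos (2 * Real.pi * x * y)) ≤
      ∫ y, max (F y) 0 * max (1 - Real.cos (2 * Real.pi * x * y)) κ :=
    integral_mono (h1c hh) hmint fun y =>
      mul_le_mul_of_nonneg_left (le_max_left _ _) (le_max_right _ _)
  have hm2 : (∫ y, max (F y) 0) * κ ≤
      ∫ y, max (F y) 0 * max (1 - Real.cos (2 * Real.pi * x * y)) κ := by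
    rw [← integral_mul_const]
    exact integral_mono (hh.mul_const κ) hmint fun y =>
      mul_le_mul_of_nonneg_left (le_max_right _ _) (le_max_right _ _)
  have hangle : 2 * Real.pi * 0.45 ^ 2 * u ≤ Real.pi / 2 := by
    nlinarith [hu.1, hu.2, Real.pi_pos]
  have hangle0 : 0 ≤ 2 * Real.pi * 0.45 ^ 2 * u := by
    have := hu.1
    positivity
  have hκ1 : κ ≤ 1 := by
    have := Real.cos_nonneg_of_neg_pi_div_two_le_of_le (by linarith [Real.pi_pos]) hangle
    linarith
  have hGκ : ∫ y, max (-F y) 0 * (1 - Real.cos (2 * Real.pi * x * y)) ≤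
      (∫ y, max (-F y) 0) * κ := by
    rw [← integral_mul_const]
    refine integral_mono (h1c hg) (hg.mul_const κ) fun y => ?_
    beta_reduce
    by_cases hy : 0.45 < |y|
    · rw [max_eq_right (by linarith [hpos y hy])]; simp
    · push Not at hy
      refine mul_le_mul_of_nonneg_left ?_ (le_max_right _ _)
      have hle : |2 * Real.pi * x * y| ≤ 2 * Real.pi * 0.45 ^ 2 * u := by
        rw [hx, abs_mul, abs_of_nonneg (by have := hu.1; positivity)]
        have : 0 ≤ 2 * Real.pi * (0.45 * u) := by have := hu.1; positivity
        nlinarith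
      have := Real.cos_le_cos_of_nonneg_of_le_pi (abs_nonneg _)
        (show 2 * Real.pi * 0.45 ^ 2 * u ≤ Real.pi by linarith [Real.pi_pos]) hle
      rw [Real.cos_abs] at this
      linarith
  rcases le_total (-F x) 0 with h | h
  · rw [max_eq_right h, zero_add]
    nlinarith
  · rw [max_eq_left h]
    linarith

/-- A continuous integrable function that is its own Fourier transform, is nonpositive at the
origin and nonnegative outside `[-0.45, 0.45]`, vanishes. -/
theorem eq_zero_of_self_dual {F : ℝ → ℝ} (hcont : Continuous F) (hF : Integrable F)
    (hself : ∀ x, F x = ∫ y, F y * Real.cos (2 * Real.pi * x * y)) (hF0 : F 0 ≤ 0)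
    (hpos : ∀ x, 0.45 < |x| → 0 ≤ F x) : F = 0 := by
  have hg := hF.neg_part
  have hh := hF.pos_part
  have hw := continuous_weight
  have hFgh : ∀ y, F y = max (F y) 0 - max (-F y) 0 := fun y => by
    rcases le_total (F y) 0 with h | h
    · rw [max_eq_right h, max_eq_left (by linarith)]; ring
    · rw [max_eq_left h, max_eq_right (by linarith)]; ring
  have heven : ∀ y, F (-y) = F y := fun y => by
    rw [hself, hself y]
    congr 1; funext z
    rw [← Real.cos_neg]; ring_nf
  set p := ∫ y, max (F y) 0 with hp
  set q := ∫ y, max (-F y) 0 with hq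
  have hp0 : 0 ≤ p := integral_nonneg fun y => le_max_right _ _
  have hq0 : 0 ≤ q := integral_nonneg fun y => le_max_right _ _
  have hpq : p ≤ q := by
    have : F 0 = p - q := by
      rw [hp, hq, ← integral_sub hh hg, hself 0]
      refine integral_congr_ae (ae_of_all _ fun y => ?_)
      simp [← hFgh]
    linarith
  set k₁ : ℝ → ℝ → ℝ := fun y u => 1 - Real.cos (2 * Real.pi * 0.45 * y * u) with hk₁
  set k₂ : ℝ → ℝ → ℝ := fun y u => max (1 - Real.cos (2 * Real.pi * 0.45 * y * u))
        (1 - Real.cos (2 * Real.pi * 0.45 ^ 2 * u)) with hk₂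
  have hc₁ : Continuous (Function.uncurry k₁) := by
    simp only [hk₁, Function.uncurry_def]; fun_prop
  have hc₂ : Continuous (Function.uncurry k₂) := by
    simp only [hk₂, Function.uncurry_def]; fun_prop
  have hb₁ : ∀ y u, |k₁ y u| ≤ 2 := fun y u => by
    simp only [hk₁]
    exact abs_le.2 ⟨by linarith [Real.cos_le_one (2 * Real.pi * 0.45 * y * u)],
      by linarith [Real.neg_one_le_cos (2 * Real.pi * 0.45 * y * u)]⟩
  have hb₂ : ∀ y u, |k₂ y u| ≤ 2 := fun y u => abs_le.2
    ⟨le_max_of_le_left (by linarith [Real.cos_le_one (2 * Real.pi * 0.45 * y * u)]),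
      max_le (by linarith [Real.neg_one_le_cos (2 * Real.pi * 0.45 * y * u)])
        (by linarith [Real.neg_one_le_cos (2 * Real.pi * 0.45 ^ 2 * u)])⟩
  have hI₁ := continuous_integral_mul hg hc₁ hb₁
  have hI₂ := continuous_integral_mul hh hc₂ hb₂
  have hgc : Continuous fun u : ℝ => max (-F (0.45 * u)) 0 := by fun_prop
  have hmain := integral_weight_mul_mono (hgc.add hI₁) (hI₂.add_const (q - p)) fun u hu =>
    max_neg_add_integral_le hF hself hF0 hpos hu
  simp only [Pi.add_apply, mul_add] at hmain
  rw [intervalIntegral.integral_add, intervalIntegral.integral_add,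
    intervalIntegral.integral_mul_const, integral_weight,
    integral_weight_mul_integral hg hc₁ hb₁, integral_weight_mul_integral hh hc₂ hb₂] at hmain
  rotate_left
  iterate 4 exact Continuous.intervalIntegrable (by fun_prop) _ _
  have hupper : 0.45 * ∫ y, max (F y) 0 * ∫ u in (0 : ℝ)..1, weight u * k₂ y u ≤ p * 0.4995 := by
    rw [← integral_const_mul, hp, ← integral_mul_const]
    refine integral_mono_of_nonneg (ae_of_all _ fun y => ?_) (hh.mul_const _)
      (ae_of_all _ fun y => ?_)
    · refine mul_nonneg (by norm_num) (mul_nonneg (le_max_right _ _)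
        (intervalIntegral.integral_nonneg zero_le_one fun u hu => ?_))
      exact mul_nonneg (weight_nonneg (abs_le.2 ⟨by linarith [hu.1], hu.2⟩))
        (le_max_of_le_left (by linarith [Real.cos_le_one (2 * Real.pi * 0.45 * y * u)]))
    · beta_reduce
      rw [mul_left_comm]
      refine mul_le_mul_of_nonneg_left ?_ (le_max_right _ _)
      have h := integral_weight_mul_max_le (θ := |2 * Real.pi * 0.45 * y|) (abs_nonneg _)
      refine le_trans (le_of_eq ?_) h
      congr 2
      funext u
      have : Real.cos (|2 * Real.pi * 0.45 * y| * u) = Real.cos (2 * Real.pi * 0.45 * y * u) := by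
        rcases abs_choice (2 * Real.pi * 0.45 * y) with h | h <;> rw [h]
        rw [neg_mul, Real.cos_neg]
      rw [this]
  -- F⁻ is even and lives on [-0.45, 0.45], so the half-interval carries half of its integral; hence
  -- 0.9.
  have hsub : ∫ u in (0 : ℝ)..1, weight u * max (-F (0.45 * u)) 0 =
      1 / 0.9 * ∫ y, max (-F y) 0 * weight (y / 0.45) := by
    have h1 := intervalIntegral.integral_comp_mul_left (a := (0 : ℝ)) (b := 1) (c := 0.45)
      (fun y => weight (y / 0.45) * max (-F y) 0) (by norm_num)
    have h2 : ∀ u : ℝ, weight (0.45 * u / 0.45) = weight u := fun u => by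
      rw [mul_div_cancel_left₀ _ (by norm_num)]
    simp only [h2] at h1
    rw [h1]
    have heven2 : ∀ y, weight (-y / 0.45) * max (-F (-y)) 0 =
        weight (y / 0.45) * max (-F y) 0 := fun y => by
      rw [heven]; unfold weight; ring
    have h3 : ∫ y in (-0.45 : ℝ)..0, weight (y / 0.45) * max (-F y) 0 =
        ∫ y in (0 : ℝ)..0.45, weight (y / 0.45) * max (-F y) 0 := by
      have := intervalIntegral.integral_comp_neg (a := (0 : ℝ)) (b := 0.45)
        (fun y => weight (y / 0.45) * max (-F y) 0)
      simp only [heven2, neg_zero] at this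
      exact this.symm
    have h4 : ∫ y, max (-F y) 0 * weight (y / 0.45) =
        ∫ y in (-0.45 : ℝ)..0.45, weight (y / 0.45) * max (-F y) 0 := by
      rw [intervalIntegral.integral_of_le (by norm_num), ← integral_Icc_eq_integral_Ioc,
        setIntegral_eq_integral_of_forall_compl_eq_zero]
      · simp_rw [mul_comm]
      · intro y hy
        have : 0.45 < |y| := by
          by_contra hcon
          exact hy (abs_le.1 (not_lt.1 hcon))
        rw [max_eq_right (by linarith [hpos y this]), mul_zero]
    have hci : ∀ a b : ℝ, IntervalIntegrable (fun y => weight (y / 0.45) * max (-F y) 0)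
        volume a b := fun a b => Continuous.intervalIntegrable (by fun_prop) _ _
    rw [h4, ← intervalIntegral.integral_add_adjacent_intervals (hci (-0.45) 0) (hci 0 0.45), h3,
      mul_zero, mul_one, smul_eq_mul]
    norm_num
    ring
  have hlower : q * (1 / 2) ≤ 0.45 * (1 / 0.9 * (∫ y, max (-F y) 0 * weight (y / 0.45)) +
      ∫ y, max (-F y) 0 * ∫ u in (0 : ℝ)..1, weight u * k₁ y u) := by
    have hi1 : Integrable fun y => max (-F y) 0 * weight (y / 0.45) := by
      refine Continuous.integrable_of_hasCompactSupport (by fun_prop) ?_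
      refine HasCompactSupport.intro (isCompact_Icc (a := (-0.45 : ℝ)) (b := 0.45)) fun y hy => ?_
      have : 0.45 < |y| := by
        by_contra hcon
        exact hy (abs_le.1 (not_lt.1 hcon))
      rw [max_eq_right (by linarith [hpos y this]), zero_mul]
    have hkc : Continuous fun y => ∫ u in (0 : ℝ)..1, weight u * k₁ y u := by
      refine intervalIntegral.continuous_parametric_intervalIntegral_of_continuous' ?_ _ _
      simp only [hk₁, Function.uncurry_def]; fun_prop
    have hi2 : Integrable fun y => max (-F y) 0 * ∫ u in (0 : ℝ)..1, weight u * k₁ y u := by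
      refine Continuous.integrable_of_hasCompactSupport (by fun_prop) ?_
      refine HasCompactSupport.intro (isCompact_Icc (a := (-0.45 : ℝ)) (b := 0.45)) fun y hy => ?_
      have : 0.45 < |y| := by
        by_contra hcon
        exact hy (abs_le.1 (not_lt.1 hcon))
      rw [max_eq_right (by linarith [hpos y this]), zero_mul]
    rw [← integral_const_mul, ← integral_add (hi1.const_mul _) hi2, ← integral_const_mul, hq,
      ← integral_mul_const]
    refine integral_mono (hg.mul_const _) (((hi1.const_mul _).add hi2).const_mul _) fun y => ?_
    beta_reduce
    have h := half_le_weight_add_integral (y / 0.45)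
    have h2 : ∀ u : ℝ, 1 - Real.cos (2 * Real.pi * 0.45 ^ 2 * u * (y / 0.45)) = k₁ y u :=
      fun u => by
        rw [hk₁]
        beta_reduce
        congr 2
        field_simp
    simp only [h2] at h
    have h3 := mul_le_mul_of_nonneg_left h (le_max_right (-F y) 0)
    norm_num at h3 ⊢
    linarith
  rw [hsub] at hmain
  have hqz : q = 0 := by
    norm_num at hmain hupper hlower
    linarith
  have hpz : p = 0 := by linarith
  have hqz' := (integral_eq_zero_iff_of_nonneg (fun y => le_max_right (-F y) 0) hg).1 hqz
  have hpz' := (integral_eq_zero_iff_of_nonneg (fun y => le_max_right (F y) 0) hh).1 hpz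
  refine (hcont.ae_eq_iff_eq volume continuous_const).1 ?_
  filter_upwards [hqz', hpz'] with y h1 h2
  rw [hFgh y]
  simp only [Pi.zero_apply] at h1 h2
  rw [h1, h2]
  exact sub_zero _

/-! ### Reduction to self-dual functions -/

theorem rfourier_eq_integral_cos {f : ℝ → ℝ} (hf : Integrable f) (y : ℝ) :
    rfourier f y = ∫ x, f x * Real.cos (2 * Real.pi * y * x) := by
  unfold rfourier
  rw [cfourier_eq_integral]
  have hint : Integrable fun x : ℝ =>
      Complex.exp (-2 * Real.pi * Complex.I * x * y) * (f x : ℂ) := by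
    refine hf.ofReal.bdd_mul (c := 1) (Continuous.aestronglyMeasurable (by fun_prop))
      (ae_of_all _ fun x => ?_)
    rw [show (-2 * Real.pi * Complex.I * x * y : ℂ) = ((-2 * Real.pi * x * y : ℝ) : ℂ) * Complex.I by
      push_cast; ring, Complex.norm_exp_ofReal_mul_I]
  have h := integral_re hint
  simp only [RCLike.re_eq_complex_re] at h
  rw [← h]
  congr 1
  funext x
  rw [show (-2 * Real.pi * Complex.I * x * y : ℂ) =
      ((-(2 * Real.pi * y * x) : ℝ) : ℂ) * Complex.I by push_cast; ring, Complex.re_mul_ofReal,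
    Complex.exp_ofReal_mul_I_re, Real.cos_neg, mul_comm]

namespace IsAdmissible

variable {f : ℝ → ℝ}

theorem ofReal_rfourier (hf : IsAdmissible f) :
    (fun y => (rfourier f y : ℂ)) = 𝓕 (fun x : ℝ => (f x : ℂ)) :=
  funext fun y => coe_rfourier hf.even y

theorem cfourier_rfourier (hf : IsAdmissible f) (x : ℝ) :
    cfourier (rfourier f) x = f x := by
  have hinv := Continuous.fourierInv_fourier_eq (f := fun x : ℝ => (f x : ℂ))
    (Complex.continuous_ofReal.comp hf.continuous) hf.integrable.ofReal hf.integrable_fourier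
  unfold cfourier
  rw [hf.ofReal_rfourier, ← neg_neg x, ← Real.fourierInv_eq_fourier_neg, hinv]
  simp [hf.even x]

theorem rfourier_rfourier (hf : IsAdmissible f) : rfourier (rfourier f) = f := by
  funext x
  unfold rfourier
  exact (congrArg Complex.re (hf.cfourier_rfourier x)).trans (Complex.ofReal_re _)

theorem integrable_rfourier (hf : IsAdmissible f) : Integrable (rfourier f) :=
  hf.integrable_fourier.re

theorem rfourier_admissible (hf : IsAdmissible f) : IsAdmissible (rfourier f) where
  continuous := by
    have : Continuous (𝓕 (fun x : ℝ => (f x : ℂ))) :=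
      VectorFourier.fourierIntegral_continuous Real.continuous_fourierChar (by fun_prop)
        hf.integrable.ofReal
    exact Complex.continuous_re.comp this
  ne_zero h := hf.ne_zero (by
    rw [← hf.rfourier_rfourier, h]
    funext x
    rw [rfourier_eq_integral_cos (integrable_zero _ _ _)]
    simp)
  even x := by
    rw [rfourier_eq_integral_cos hf.integrable, rfourier_eq_integral_cos hf.integrable]
    congr 1; funext y
    rw [← Real.cos_neg]; ring_nf
  integrable := hf.integrable_rfourier
  integrable_fourier := by
    rw [show cfourier (rfourier f) = fun x => (f x : ℂ) from funext hf.cfourier_rfourier]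
    exact hf.integrable.ofReal
  apply_zero_le := hf.fourier_zero_le
  fourier_zero_le := by rw [hf.rfourier_rfourier]; exact hf.apply_zero_le

theorem integral_nonpos (hf : IsAdmissible f) : ∫ x, f x ≤ 0 := by
  have := hf.fourier_zero_le
  rw [rfourier_eq_integral_cos hf.integrable] at this
  simpa using this

/-- Otherwise f ≥ 0 off the origin while its integral is nonpositive, forcing f = 0. This excludes a
product 0·∞. -/
theorem lastSign_ne_zero (hf : IsAdmissible f) : lastSign f ≠ 0 := by
  intro h
  have hnn : ∀ x, x ≠ 0 → 0 ≤ f x := by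
    intro x hx
    have hlt : lastSign f < ENNReal.ofReal |x| := by
      rw [h]; exact ENNReal.ofReal_pos.2 (abs_pos.2 hx)
    obtain ⟨a, ⟨r, hr, hfr, rfl⟩, har⟩ := sInf_lt_iff.1 hlt
    exact hfr x ((ENNReal.ofReal_lt_ofReal_iff (abs_pos.2 hx)).1 har)
  have hae : 0 ≤ᵐ[volume] f := by
    filter_upwards [Measure.ae_ne volume 0] with x hx using hnn x hx
  have h0 : ∫ x, f x = 0 := le_antisymm hf.integral_nonpos (integral_nonneg_of_ae hae)
  exact hf.ne_zero ((hf.continuous.ae_eq_iff_eq volume continuous_const).1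
    ((integral_eq_zero_iff_of_nonneg_ae hae hf.integrable).1 h0))

/-- The scaled sum of an admissible function and its Fourier transform is self-dual. -/
theorem self_dual_scaling (hf : IsAdmissible f) {s : ℝ} (hs : 0 < s) (x : ℝ) :
    f (s * x) + s⁻¹ * rfourier f (x / s) =
      ∫ y, (f (s * y) + s⁻¹ * rfourier f (y / s)) * Real.cos (2 * Real.pi * x * y) := by
  have hi1 : Integrable fun y => f (s * y) := hf.integrable.comp_mul_left' hs.ne'
  have hi2 : Integrable fun y => s⁻¹ * rfourier f (y / s) :=
    (hf.integrable_rfourier.comp_div hs.ne').const_mul _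
  simp_rw [add_mul]
  rw [integral_add (integrable_mul_cos hi1 x) (integrable_mul_cos hi2 x), add_comm]
  congr 1
  · have h := Measure.integral_comp_mul_left
      (fun y => f y * Real.cos (2 * Real.pi * (x / s) * y)) s
    rw [← rfourier_eq_integral_cos hf.integrable, abs_of_pos (inv_pos.2 hs), smul_eq_mul] at h
    rw [← h]
    congr 1; funext y
    congr 2
    field_simp
  · have h := Measure.integral_comp_div
      (fun y => rfourier f y * Real.cos (2 * Real.pi * (s * x) * y)) s
    rw [← rfourier_eq_integral_cos hf.integrable_rfourier, abs_of_pos hs, smul_eq_mul,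
      hf.rfourier_rfourier] at h
    rw [eq_comm, show f (s * x) = s⁻¹ * (s * f (s * x)) by field_simp, ← h, ← integral_const_mul]
    congr 1; funext y
    rw [mul_assoc]
    congr 3
    field_simp

end IsAdmissible

/-- A continuous integrable function that equals minus its Fourier transform and is supported in
`[-0.45, 0.45]` vanishes. -/
theorem eq_zero_of_anti_self_dual {g : ℝ → ℝ} (hcont : Continuous g)
    (hself : ∀ x, g x = -∫ y, g y * Real.cos (2 * Real.pi * x * y))
    (hsupp : ∀ x, 0.45 < |x| → g x = 0) : g = 0 := by
  have hout : ∀ x, x ∉ Icc (-0.45 : ℝ) 0.45 → g x = 0 := fun x hx => hsupp x (by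
    by_contra hcon
    exact hx (abs_le.1 (not_lt.1 hcon)))
  have hcs : HasCompactSupport g := HasCompactSupport.intro isCompact_Icc hout
  obtain ⟨x₀, hx₀⟩ := hcont.norm.exists_forall_ge_of_hasCompactSupport hcs.norm
  -- 0.9 is the length of the supporting interval.
  have hbound : ‖g x₀‖ ≤ ‖g x₀‖ * 0.9 := by
    have h1 : ∫ y, g y * Real.cos (2 * Real.pi * x₀ * y) =
        ∫ y in Icc (-0.45 : ℝ) 0.45, g y * Real.cos (2 * Real.pi * x₀ * y) := by
      rw [setIntegral_eq_integral_of_forall_compl_eq_zero]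
      intro y hy
      rw [hout y hy, zero_mul]
    have h2 := norm_setIntegral_le_of_norm_le_const (μ := volume) (s := Icc (-0.45 : ℝ) 0.45)
      (f := fun y => g y * Real.cos (2 * Real.pi * x₀ * y)) (C := ‖g x₀‖)
      (by simp) fun y _ => by
        rw [norm_mul]
        exact (mul_le_of_le_one_right (norm_nonneg _) (Real.abs_cos_le_one _)).trans (hx₀ y)
    rw [← h1, ← norm_neg, ← hself, measureReal_def, Real.volume_Icc,
      ENNReal.toReal_ofReal (by norm_num)] at h2
    norm_num at h2 ⊢
    exact h2
  funext x
  have := hx₀ x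
  exact norm_le_zero_iff.1 (by linarith [norm_nonneg (g x₀)])

theorem IsAdmissible.le_mul_of_nonneg_outside {f : ℝ → ℝ} (hf : IsAdmissible f) {r₁ r₂ : ℝ}
    (hr₁ : 0 < r₁) (h₁ : ∀ x, r₁ < |x| → 0 ≤ f x) (h₂ : ∀ x, r₂ < |x| → 0 ≤ rfourier f x) :
    0.2025 ≤ r₁ * r₂ := by
  by_contra! hlt
  -- This scale moves r₁ to exactly 0.45 and r₂ to r₂s, which is below 0.45 because r₁r₂ < 0.45².
  set s := r₁ / 0.45 with hs
  have hs0 : 0 < s := by positivity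
  have hscale : r₂ * s ≤ 0.45 := by
    rw [hs, ← mul_div_assoc, div_le_iff₀ (by norm_num)]
    norm_num at hlt ⊢
    linarith
  have hA1 : ∀ x, 0.45 < |x| → 0 ≤ f (s * x) := fun x hx => h₁ _ (by
    rw [abs_mul, abs_of_pos hs0, hs, div_mul_eq_mul_div, lt_div_iff₀ (by norm_num)]
    exact mul_lt_mul_of_pos_left hx hr₁)
  have hA2 : ∀ x, 0.45 < |x| → 0 ≤ s⁻¹ * rfourier f (x / s) := fun x hx =>
    mul_nonneg (inv_nonneg.2 hs0.le) (h₂ _ (by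
      rw [abs_div, abs_of_pos hs0, lt_div_iff₀ hs0]
      linarith))
  have hcf := hf.continuous
  have hcf' := hf.rfourier_admissible.continuous
  have hi1 : Integrable fun y => f (s * y) := hf.integrable.comp_mul_left' hs0.ne'
  have hi2 : Integrable fun y => s⁻¹ * rfourier f (y / s) :=
    (hf.integrable_rfourier.comp_div hs0.ne').const_mul _
  have hzero := eq_zero_of_self_dual (F := fun x => f (s * x) + s⁻¹ * rfourier f (x / s))
    (by fun_prop) (hi1.add hi2) (hf.self_dual_scaling hs0)
    (by
      have h1 := hf.apply_zero_le
      have h3 : s⁻¹ * rfourier f 0 ≤ 0 :=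
        mul_nonpos_of_nonneg_of_nonpos (inv_nonneg.2 hs0.le) hf.fourier_zero_le
      simp only [mul_zero, zero_div]
      linarith)
    fun x hx => add_nonneg (hA1 x hx) (hA2 x hx)
  have hz : ∀ x, f (s * x) + s⁻¹ * rfourier f (x / s) = 0 := congrFun hzero
  -- Beyond 0.45 two nonnegative summands add up to zero, so each vanishes there; everywhere, the
  -- zero sum says that f(s·) is minus its transform.
  have hg : (fun x => f (s * x)) = 0 := by
    refine eq_zero_of_anti_self_dual (by fun_prop) (fun x => ?_) fun x hx => ?_
    · have h := Measure.integral_comp_mul_left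
        (fun y => f y * Real.cos (2 * Real.pi * (x / s) * y)) s
      rw [← rfourier_eq_integral_cos hf.integrable, abs_of_pos (inv_pos.2 hs0), smul_eq_mul] at h
      have h' : ∫ y, f (s * y) * Real.cos (2 * Real.pi * x * y) = s⁻¹ * rfourier f (x / s) := by
        rw [← h]
        congr 1; funext y
        congr 2
        field_simp
      rw [h']
      linarith [hz x]
    · linarith [hz x, hA1 x hx, hA2 x hx]
  refine hf.ne_zero (funext fun x => ?_)
  have := congrFun hg (x / s)
  simpa [mul_div_cancel₀, hs0.ne'] using this

theorem IsAdmissible.le_lastSign_mul {f : ℝ → ℝ} (hf : IsAdmissible f) :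
    ENNReal.ofReal 0.2025 ≤ lastSign f * lastSign (rfourier f) := by
  have ha := hf.lastSign_ne_zero
  have hb := hf.rfourier_admissible.lastSign_ne_zero
  rcases eq_or_ne (lastSign f) ⊤ with ht | ht
  · rw [ht, ENNReal.top_mul hb]; exact le_top
  refine (ENNReal.div_le_iff' ha ht).1 (le_sInf ?_)
  rintro _ ⟨r₂, hr₂, h₂, rfl⟩
  have hr₂' : ENNReal.ofReal r₂ ≠ 0 := (ENNReal.ofReal_pos.2 hr₂).ne'
  rw [ENNReal.div_le_iff' ha ht, ← ENNReal.div_le_iff hr₂' ENNReal.ofReal_ne_top]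
  refine le_sInf ?_
  rintro _ ⟨r₁, hr₁, h₁, rfl⟩
  rw [ENNReal.div_le_iff hr₂' ENNReal.ofReal_ne_top, ← ENNReal.ofReal_mul hr₁.le]
  exact ENNReal.ofReal_le_ofReal (hf.le_mul_of_nonneg_outside hr₁ h₁ h₂)

/-! ### Fourier transforms of Gaussians times polynomials -/

section GaussianPolynomial

open Polynomial

theorem integrable_eval_mul_gaussian (q : ℝ[X]) :
    Integrable fun x : ℝ => q.eval x * Real.exp (-Real.pi * x ^ 2) := by
  simp_rw [eval_eq_sum_range, Finset.sum_mul, mul_assoc]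
  refine integrable_finsetSum _ fun n _ => Integrable.const_mul ?_ _
  have h := integrable_rpow_mul_exp_neg_mul_sq Real.pi_pos (s := n)
    (by have := n.cast_nonneg (α := ℝ); linarith)
  simpa only [Real.rpow_natCast] using h

/-- The function `q(2πx²) exp(-πx²)`. -/
noncomputable def gaussPoly (q : ℝ[X]) (x : ℝ) : ℝ :=
  q.eval (2 * Real.pi * x ^ 2) * Real.exp (-Real.pi * x ^ 2)

theorem continuous_gaussPoly (q : ℝ[X]) : Continuous (gaussPoly q) := by
  unfold gaussPoly; fun_prop

theorem integrable_pow_mul_gaussPoly (n : ℕ) (q : ℝ[X]) :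
    Integrable fun x => x ^ n * gaussPoly q x := by
  refine (integrable_eval_mul_gaussian
    (X ^ n * q.comp (C (2 * Real.pi) * X ^ 2))).congr (ae_of_all _ fun x => ?_)
  simp only [gaussPoly, eval_mul, eval_pow, eval_X, eval_comp, eval_C]
  ring

theorem integrable_gaussPoly (q : ℝ[X]) : Integrable (gaussPoly q) := by
  simpa using integrable_pow_mul_gaussPoly 0 q

theorem hasDerivAt_gaussPoly (q : ℝ[X]) (x : ℝ) :
    HasDerivAt (gaussPoly q) (x * gaussPoly (C (2 * Real.pi) * (2 * derivative q - q)) x) x := by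
  have h1 : HasDerivAt (fun x : ℝ => 2 * Real.pi * x ^ 2) (2 * Real.pi * (2 * x)) x := by
    simpa using (hasDerivAt_pow 2 x).const_mul (2 * Real.pi)
  have h2 : HasDerivAt (fun x : ℝ => -Real.pi * x ^ 2) (-Real.pi * (2 * x)) x := by
    simpa using (hasDerivAt_pow 2 x).const_mul (-Real.pi)
  have h3 : HasDerivAt (fun x : ℝ => q.eval (2 * Real.pi * x ^ 2))
      (q.derivative.eval (2 * Real.pi * x ^ 2) * (2 * Real.pi * (2 * x))) x :=
    HasDerivAt.comp x (q.hasDerivAt _) h1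
  refine (h3.mul h2.exp).congr_deriv ?_
  simp only [gaussPoly, eval_mul, eval_sub, eval_C, eval_ofNat]
  ring

/-- `GaussPolyDual q r` says that `r(2πy²) exp(-πy²)` is the Fourier transform of
`q(2πx²) exp(-πx²)`. -/
def GaussPolyDual (q r : ℝ[X]) : Prop :=
  (𝓕 fun x : ℝ => (gaussPoly q x : ℂ)) = fun y => (gaussPoly r y : ℂ)

theorem GaussPolyDual.one : GaussPolyDual 1 1 := by
  have h := fourier_gaussian_pi (b := 1) (by simp)
  unfold GaussPolyDual gaussPoly
  convert h using 1
  · congr 1; funext x; simp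
  · funext y; simp

theorem GaussPolyDual.add {q₁ r₁ q₂ r₂ : ℝ[X]} (h₁ : GaussPolyDual q₁ r₁)
    (h₂ : GaussPolyDual q₂ r₂) : GaussPolyDual (q₁ + q₂) (r₁ + r₂) := by
  have hsum : ∀ (a b : ℝ[X]), (fun x => (gaussPoly (a + b) x : ℂ)) =
      (fun x => (gaussPoly a x : ℂ)) + fun x => (gaussPoly b x : ℂ) := fun a b => by
    funext x
    simp only [gaussPoly, eval_add, Pi.add_apply]
    push_cast
    ring
  unfold GaussPolyDual at *
  rw [hsum, hsum, ← h₁, ← h₂]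
  exact VectorFourier.fourierIntegral_add Real.continuous_fourierChar (by fun_prop)
    (integrable_gaussPoly q₁).ofReal (integrable_gaussPoly q₂).ofReal

theorem GaussPolyDual.const_mul {q r : ℝ[X]} (h : GaussPolyDual q r) (a : ℝ) :
    GaussPolyDual (C a * q) (C a * r) := by
  have hmul : ∀ b : ℝ[X], (fun x => (gaussPoly (C a * b) x : ℂ)) =
      (a : ℂ) • fun x => (gaussPoly b x : ℂ) := fun b => by
    funext x
    simp only [gaussPoly, eval_mul, eval_C, Pi.smul_apply, smul_eq_mul]
    push_cast
    ring
  unfold GaussPolyDual at *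
  rw [hmul, hmul, ← h]
  exact VectorFourier.fourierIntegral_const_smul _ _ _ _ _

/-- Multiplication by -4π²x² becomes the second derivative of the transform; the operator on `r` is
-1/(2π) times that derivative, written in the variable 2πy². -/
theorem GaussPolyDual.X_mul {q r : ℝ[X]} (h : GaussPolyDual q r) :
    GaussPolyDual (X * q) ((1 - X) * r + (4 * X - 2) * derivative r
      - 4 * X * derivative (derivative r)) := by
  have hcast : ∀ n : ℕ, Integrable fun x : ℝ => x ^ n • (gaussPoly q x : ℂ) := fun n => by
    refine (integrable_pow_mul_gaussPoly n q).ofReal.congr (ae_of_all _ fun x => ?_)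
    simp only [Complex.real_smul]
    push_cast
    rfl
  have h2 := Real.iteratedDeriv_fourier (N := 2) (n := 2)
    (f := fun x : ℝ => (gaussPoly q x : ℂ)) (fun n _ => hcast n) le_rfl
  unfold GaussPolyDual at *
  have hd1 : ∀ (s : ℝ[X]) (y : ℝ), HasDerivAt (fun y => (gaussPoly s y : ℂ))
      ((y * gaussPoly (C (2 * Real.pi) * (2 * derivative s - s)) y : ℝ) : ℂ) y :=
    fun s y => (hasDerivAt_gaussPoly s y).ofReal_comp
  have hd2 : ∀ y : ℝ, iteratedDeriv 2 (fun y => (gaussPoly r y : ℂ)) y =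
      ((-2 * Real.pi * gaussPoly ((1 - X) * r + (4 * X - 2) * derivative r
        - 4 * X * derivative (derivative r)) y : ℝ) : ℂ) := by
    intro y
    rw [iteratedDeriv_succ, iteratedDeriv_one]
    have : deriv (fun y => (gaussPoly r y : ℂ)) = fun y =>
        ((y * gaussPoly (C (2 * Real.pi) * (2 * derivative r - r)) y : ℝ) : ℂ) :=
      funext fun y => (hd1 r y).deriv
    rw [this]
    refine (((hasDerivAt_id y).mul (hasDerivAt_gaussPoly _ y)).ofReal_comp).deriv.trans ?_
    congr 1
    simp only [id, gaussPoly, eval_mul, eval_sub, eval_add, eval_C, eval_ofNat, eval_X, eval_one,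
      derivative_mul, derivative_sub, derivative_C, derivative_ofNat]
    simp
    ring
  funext y
  have hpi : (-2 * Real.pi : ℂ) ≠ 0 := by
    simp [Real.pi_ne_zero]
  have h3 := congrFun h2 y
  rw [h, hd2] at h3
  have h4 : (fun x : ℝ => (-2 * Real.pi * Complex.I * x : ℂ) ^ 2 • (gaussPoly q x : ℂ)) =
      (-2 * Real.pi : ℂ) • fun x : ℝ => (gaussPoly (X * q) x : ℂ) := by
    funext x
    simp only [gaussPoly, eval_mul, eval_X, Pi.smul_apply, smul_eq_mul]
    push_cast
    rw [mul_pow, mul_pow, Complex.I_sq]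
    ring
  rw [h4] at h3
  have h5 : 𝓕 ((-2 * Real.pi : ℂ) • fun x : ℝ => (gaussPoly (X * q) x : ℂ)) =
      (-2 * Real.pi : ℂ) • 𝓕 (fun x : ℝ => (gaussPoly (X * q) x : ℂ)) :=
    VectorFourier.fourierIntegral_const_smul _ _ _ _ _
  rw [h5, Pi.smul_apply, smul_eq_mul] at h3
  push_cast at h3
  exact (mul_left_cancel₀ hpi h3).symm

/-- A polynomial in the span of the Laguerre polynomials of index `0, 2, 4, 6`. -/
noncomputable def extremalPoly : ℝ[X] :=
  C (-146655) * X + C 142965 * X ^ 2 + C (-48720) * X ^ 3 + C 7440 * X ^ 4 + C (-528) * X ^ 5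
    + C 16 * X ^ 6

/-- Laguerre polynomials of parameter -1/2 in 2πx², times the Gaussian, have Fourier eigenvalue
(-1)ⁿ, so even indices are fixed. The check here goes monomial by monomial. -/
theorem extremalPoly_dual : GaussPolyDual extremalPoly extremalPoly := by
  have step : ∀ {q r s q' : ℝ[X]}, GaussPolyDual q r → q' = X * q →
      s = (1 - X) * r + (4 * X - 2) * derivative r - 4 * X * derivative (derivative r) →
      GaussPolyDual q' s := fun h h1 h2 => by
    rw [h1, h2]; exact h.X_mul
  have m1 : GaussPolyDual X (1 - X) := step .one (by ring) (by simp)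
  have m2 : GaussPolyDual (X ^ 2) (3 - 6 * X + X ^ 2) :=
    step m1 (by ring) (by simp; ring)
  have m3 : GaussPolyDual (X ^ 3) (15 - 45 * X + 15 * X ^ 2 - X ^ 3) :=
    step m2 (by ring) (by simp; ring)
  have m4 : GaussPolyDual (X ^ 4) (105 - 420 * X + 210 * X ^ 2 - 28 * X ^ 3 + X ^ 4) :=
    step m3 (by ring) (by simp [map_ofNat]; ring)
  have m5 : GaussPolyDual (X ^ 5)
      (945 - 4725 * X + 3150 * X ^ 2 - 630 * X ^ 3 + 45 * X ^ 4 - X ^ 5) :=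
    step m4 (by ring) (by simp [map_ofNat]; ring)
  have m6 : GaussPolyDual (X ^ 6) (10395 - 62370 * X + 51975 * X ^ 2 - 13860 * X ^ 3
      + 1485 * X ^ 4 - 66 * X ^ 5 + X ^ 6) :=
    step m5 (by ring) (by simp [map_ofNat]; ring)
  have h := (((((m1.const_mul (-146655)).add (m2.const_mul 142965)).add
    (m3.const_mul (-48720))).add (m4.const_mul 7440)).add (m5.const_mul (-528))).add
      (m6.const_mul 16)
  unfold extremalPoly
  convert h using 1
  simp only [map_neg, map_ofNat]
  ring

theorem extremalPoly_eval (t : ℝ) : extremalPoly.eval t =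
    t * (16 * t ^ 5 - 528 * t ^ 4 + 7440 * t ^ 3 - 48720 * t ^ 2 + 142965 * t - 146655) := by
  simp [extremalPoly]
  ring

/-- The quintic factor has positive Bernstein coefficients on [2.2169, 5]; beyond 5 it is expanded
around 5. -/
theorem extremalPoly_eval_nonneg {t : ℝ} (ht : 2.2169 ≤ t) : 0 ≤ extremalPoly.eval t := by
  rw [extremalPoly_eval]
  refine mul_nonneg (by linarith) ?_
  rcases le_total t 5 with h5 | h5
  · have h1 : 0 ≤ t - 2.2169 := by linarith
    have h2 : 0 ≤ 5 - t := by linarith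
    have h : 0 ≤ 700898004444797949584 / 16697215662601882448151 * (t - 2.2169) ^ 0 * (5 - t) ^ 5 +
        4335852313413266917120000 / 16697215662601882448151 * (t - 2.2169) ^ 1 * (5 - t) ^ 4 +
        7216602099287192000000000 / 16697215662601882448151 * (t - 2.2169) ^ 2 * (5 - t) ^ 3 +
        3282008984480000000000000 / 16697215662601882448151 * (t - 2.2169) ^ 3 * (5 - t) ^ 2 +
        150402850000000000000000 / 16697215662601882448151 * (t - 2.2169) ^ 4 * (5 - t) ^ 1 +
        17000000000000000000000 / 16697215662601882448151 * (t - 2.2169) ^ 5 * (5 - t) ^ 0 := by positivity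
    refine h.trans_eq ?_
    ring
  · obtain ⟨s, rfl⟩ : ∃ s, t = 5 + s := ⟨t - 5, by ring⟩
    have hs : 0 ≤ s := by linarith
    have h1 : 0 ≤ 170 - 235 * s + 100 * s ^ 2 := by nlinarith [sq_nonneg (20 * s - 23.5)]
    have h2 : 0 ≤ s ^ 3 * (880 - 128 * s + 16 * s ^ 2) :=
      mul_nonneg (pow_nonneg hs 3) (by nlinarith [sq_nonneg (s - 4)])
    nlinarith [sq_nonneg s]

end GaussianPolynomial

/-! ### The example for the upper bound -/

/-- A self-dual admissible function whose last sign change is before `0.594`. -/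
noncomputable def extremalFun : ℝ → ℝ := gaussPoly extremalPoly

theorem cfourier_extremalFun : cfourier extremalFun = fun y => (extremalFun y : ℂ) :=
  extremalPoly_dual

theorem rfourier_extremalFun : rfourier extremalFun = extremalFun := by
  funext y
  unfold rfourier
  rw [cfourier_extremalFun, Complex.ofReal_re]

theorem extremalFun_zero : extremalFun 0 = 0 := by
  simp [extremalFun, gaussPoly, extremalPoly_eval]

theorem extremalFun_admissible : IsAdmissible extremalFun where
  continuous := continuous_gaussPoly _
  ne_zero h := by
    -- At this point 2πx² = 1, which is not a root of `extremalPoly`.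
    have h1 := congrFun h (√(1 / (2 * Real.pi)))
    simp only [extremalFun, gaussPoly] at h1
    rw [Real.sq_sqrt (by positivity), mul_one_div_cancel (by positivity), extremalPoly_eval] at h1
    have := Real.exp_ne_zero (-Real.pi * (1 / (2 * Real.pi)))
    norm_num [this] at h1
  even x := by simp [extremalFun, gaussPoly]
  integrable := integrable_gaussPoly _
  integrable_fourier := by
    rw [cfourier_extremalFun]
    exact (integrable_gaussPoly _).ofReal
  apply_zero_le := extremalFun_zero.le
  fourier_zero_le := by rw [rfourier_extremalFun]; exact extremalFun_zero.le

theorem lastSign_extremalFun_le : lastSign extremalFun ≤ ENNReal.ofReal 0.594 := by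
  refine sInf_le ⟨0.594, by norm_num, fun x hx => ?_, rfl⟩
  refine mul_nonneg (extremalPoly_eval_nonneg ?_) (Real.exp_pos _).le
  have h1 : (0.594 : ℝ) ^ 2 ≤ x ^ 2 := by
    rw [← sq_abs x]
    exact pow_le_pow_left₀ (by norm_num) hx.le 2
  have h2 := Real.pi_gt_d6
  norm_num at h1 h2 ⊢
  nlinarith

theorem theorem1p2 :
    (∀ f : ℝ → ℝ, IsAdmissible f →
      ENNReal.ofReal 0.2025 ≤ lastSign f * lastSign (rfourier f)) ∧
    ¬ (∀ f : ℝ → ℝ, IsAdmissible f →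
      ENNReal.ofReal 0.353 ≤ lastSign f * lastSign (rfourier f)) := by
  refine ⟨fun f hf => hf.le_lastSign_mul, fun h => ?_⟩
  have h1 := h extremalFun extremalFun_admissible
  rw [rfourier_extremalFun] at h1
  have h2 := h1.trans (mul_le_mul' lastSign_extremalFun_le lastSign_extremalFun_le)
  rw [← ENNReal.ofReal_mul (by norm_num), ENNReal.ofReal_le_ofReal_iff (by norm_num)] at h2
  norm_num at h2
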